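/- Let $\mathscr M$ be a von Neumann algebra on a complex Hilbert space $\mathscr H$ (not necessarily separable), with identity $I$. For $A\in\mathscr M$ let $\mathcal R(A)$ denote the range projection of $A$, i.e. the orthogonal projection onto the closure of the range of $A$. Let $\Phi\colon\mathscr M\to\mathscr M$ be a map (not assumed linear or continuous) that is - ortho-additive: $\Phi(A+B)=\Phi(A)+\Phi(B)$ for all $A,B\in\mathscr M$ with $A^*B=0$; and - range-contractive: $\mathcal R(\Phi(A))\leqslant\mathcal R(A)$ for all $A\in\mathscr M$. If $W\in\mathscr M$ is a partial isometry such that $WW^*\preceq I-WW^*$, then $$\Phi(W)=W\Phi(I).$$ Here, for projections $P,Q\in\mathscr M$, $P\preceq Q$ means that $P$ is Murray–von Neumann equivalent in $\mathscr M$ to a subprojection of $Q$: there are a partial isometry $V\in\mathscr M$ and a projection $Q_0\in\mathscr M$ with $V^*V=P$ and $VV^*=Q_0\leqslant Q$. -/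

import Mathlib

namespace VonNeumannAlgebra

variable {H : Type*} [NormedAddCommGroup H] [InnerProductSpace ℂ H] [CompleteSpace H]
variable {K : Type*} [NormedAddCommGroup K] [InnerProductSpace ℂ K] [CompleteSpace K]

/-- The range projection of a bounded operator `A`: the orthogonal projection of `H` onto the
closure of the range of `A`. -/
noncomputable def rangeProjection (A : H →L[ℂ] H) : H →L[ℂ] H :=
  A.range.topologicalClosure.starProjection

/-- Two operators `A`, `B` in a von Neumann algebra are orthogonal if `A* B = 0`. -/
def IsOrtho {M : VonNeumannAlgebra H} (A B : M) : Prop :=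
  star A * B = 0

/-- A (not necessarily linear) map between von Neumann algebras is ortho-additive if it is
additive on orthogonal pairs. -/
def IsOrthoAdditive {M : VonNeumannAlgebra H} {N : VonNeumannAlgebra K} (φ : M → N) : Prop :=
  ∀ A B : M, IsOrtho A B → φ (A + B) = φ A + φ B

/-- A (not necessarily linear) self-map of a von Neumann algebra is range-contractive if the
range projection of `Φ A` is dominated by the range projection of `A`, for every `A`. -/
def IsRangeContractive {M : VonNeumannAlgebra H} (Φ : M → M) : Prop :=
  ∀ A : M, rangeProjection (Φ A : H →L[ℂ] H) ≤ rangeProjection (A : H →L[ℂ] H)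

/-- A partial isometry: an element `V` such that `V* V` is a projection. -/
def IsPartialIsometry {M : VonNeumannAlgebra H} (V : M) : Prop :=
  IsStarProjection (star V * V)

/-- Murray-von Neumann equivalence `P ∼ Q` relative to `M`. -/
def MvNEquiv {M : VonNeumannAlgebra H} (P Q : M) : Prop :=
  ∃ V : M, IsPartialIsometry V ∧ star V * V = P ∧ V * star V = Q

/-- `P` is weaker than `Q` relative to `M`: `P` is equivalent to a subprojection of `Q`. -/
def IsWeaker {M : VonNeumannAlgebra H} (P Q : M) : Prop :=
  ∃ Q₀ : M, IsStarProjection Q₀ ∧ (Q₀ : H →L[ℂ] H) ≤ (Q : H →L[ℂ] H) ∧ MvNEquiv P Q₀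

end VonNeumannAlgebra

/-!
Range contractivity says precisely that every left annihilator of `A` in `M` annihilates `Φ A`;
together with ortho-additivity this turns the problem into algebra in the star ring `M`.

Three consequences carry the proof.
* For a projection `P`, splitting `1 = P + (1 - P)` gives `Φ P = P * Φ 1`.
* If the range of `A` lies in a projection `G` and the range of `B` is orthogonal to `G`, then
  `Φ (B * A) = B * Φ A`: the range of `A + B * A` lies in the graph of `B` over `G`, hence so does
  that of `Φ (A + B * A) = Φ A + Φ (B * A)`.
* If `V` maps the range of `E` isometrically onto an orthogonal subspace, then `Φ` is additive on
  the operators with range in `E`: in `(x + y) + V * (x - y) = (x + V * x) + (y - V * y)` all the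
  sums on both sides are sums of orthogonal pairs, and `E` annihilates the terms involving `V`.

With `E = W * star W`, the last point splits `Φ W` as `Φ (W * E) + Φ (W * (1 - E))`. Since `W` has
range orthogonal to `1 - E`, the second term is `W * (1 - E) * Φ 1`. For the first one, both `V` and
`V * W` have range orthogonal to `E`, so `V * Φ (W * E) = Φ (V * W * E) = V * W * E * Φ 1`, and `V`
is cancelled by `star V * V = E`.
-/

namespace VonNeumannAlgebra

variable {H : Type*} [NormedAddCommGroup H] [InnerProductSpace ℂ H] [CompleteSpace H]
  {M : VonNeumannAlgebra H} {Φ : M → M}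

theorem IsPartialIsometry.mul_star_mul_self {V : M} (hV : IsPartialIsometry V) :
    V * star V * V = V := by
  have hi : star V * V * (star V * V) = star V * V := hV.isIdempotentElem
  have h : star (V * star V * V - V) * (V * star V * V - V) = 0 := by
    simp only [star_sub, star_mul, star_star, sub_mul, mul_sub]
    simp only [mul_assoc] at hi ⊢
    simp only [hi, sub_self]
  have h' : star ((V * star V * V - V : M) : H →L[ℂ] H) * ((V * star V * V - V : M) : H →L[ℂ] H)
      = 0 := congrArg (Subtype.val : M → H →L[ℂ] H) h
  exact sub_eq_zero.1 (Subtype.ext (CStarRing.star_mul_self_eq_zero_iff _ |>.1 h'))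

theorem IsRangeContractive.range_le (hΦ : IsRangeContractive Φ) (A : M) :
    (Φ A : H →L[ℂ] H).range ≤ (A : H →L[ℂ] H).range.topologicalClosure :=
  (Submodule.le_topologicalClosure _).trans
    (Submodule.starProjection_le_starProjection_iff.1 (hΦ A))

/-- Left annihilators of `A` annihilate `Φ A`, since their kernel is a closed subspace containing
the range of `A`. -/
theorem IsRangeContractive.mul_eq_zero (hΦ : IsRangeContractive Φ) {C A : M} (h : C * A = 0) :
    C * Φ A = 0 := by
  have h' : (C : H →L[ℂ] H) * (A : H →L[ℂ] H) = 0 := congrArg (Subtype.val : M → H →L[ℂ] H) h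
  have hle : (A : H →L[ℂ] H).range.topologicalClosure ≤ (C : H →L[ℂ] H).ker := by
    refine Submodule.topologicalClosure_minimal _ ?_ (C : H →L[ℂ] H).isClosed_ker
    rintro _ ⟨x, rfl⟩
    exact DFunLike.congr_fun h' x
  apply Subtype.ext
  ext x
  exact hle (hΦ.range_le A ⟨x, rfl⟩)

theorem IsRangeContractive.mul_eq_self (hΦ : IsRangeContractive Φ) {G A : M} (h : G * A = A) :
    G * Φ A = Φ A := by
  have := hΦ.mul_eq_zero (C := 1 - G) (A := A) (by rw [sub_mul, one_mul, h, sub_self])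
  rw [sub_mul, one_mul, sub_eq_zero] at this
  exact this.symm

theorem map_isStarProjection (hadd : IsOrthoAdditive Φ) (hΦ : IsRangeContractive Φ) {P : M}
    (hP : IsStarProjection P) : Φ P = P * Φ 1 := by
  have hi : P * P = P := hP.isIdempotentElem
  have hs : star P = P := hP.isSelfAdjoint
  have h0 : P * (1 - P) = 0 := by rw [mul_sub, mul_one, hi, sub_self]
  have h := hadd P (1 - P) (by rw [IsOrtho, hs, h0])
  rw [add_sub_cancel] at h
  rw [h, mul_add, hΦ.mul_eq_self hi, hΦ.mul_eq_zero h0, add_zero]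

/-- `Φ` commutes with left multiplication by `B` on operators with range in `G`, provided the range
of `B` is orthogonal to `G`. -/
theorem map_mul_of_orthogonal (hadd : IsOrthoAdditive Φ) (hΦ : IsRangeContractive Φ) {G A B : M}
    (hG : IsStarProjection G) (hA : G * A = A) (hB : G * B = 0) : Φ (B * A) = B * Φ A := by
  have hs : star G = G := hG.isSelfAdjoint
  have hBA : G * (B * A) = 0 := by rw [← mul_assoc, hB, zero_mul]
  have hort : IsOrtho A (B * A) := by
    rw [IsOrtho]
    nth_rw 1 [← hA]
    rw [star_mul, hs, mul_assoc, hBA, mul_zero]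
  -- The kernel of `1 - G - B * G` is the graph of `B` over the range of `G`.
  have h := hΦ.mul_eq_zero (C := 1 - G - B * G) (A := A + B * A) (by
    simp only [sub_mul, mul_add, one_mul, mul_assoc, hA, hBA, mul_zero]
    abel)
  rw [hadd _ _ hort] at h
  simp only [sub_mul, mul_add, one_mul, mul_assoc, hΦ.mul_eq_self hA, hΦ.mul_eq_zero hBA,
    mul_zero] at h
  rw [← sub_eq_zero, ← h]
  abel

/-- `Φ` is additive on the operators with range in `E`, when `V` maps the range of `E`
isometrically onto a subspace orthogonal to it. -/
theorem map_add_of_mul_eq_self (hadd : IsOrthoAdditive Φ) (hΦ : IsRangeContractive Φ) {E V x y : M}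
    (hE : IsStarProjection E) (hV : star V * V = E) (hEV : E * V = 0)
    (hx : E * x = x) (hy : E * y = y) : Φ (x + y) = Φ x + Φ y := by
  have hs : star E = E := hE.isSelfAdjoint
  have hEV' (z : M) : E * (V * z) = 0 := by rw [← mul_assoc, hEV, zero_mul]
  have hVV (z : M) : star V * (V * z) = E * z := by rw [← mul_assoc, hV]
  have hxE : star x * E = star x := by rw [← hs, ← star_mul, hx]
  have hor {u : M} (hu : E * u = u) (z : M) : star u * (V * z) = 0 := by
    rw [← hu, star_mul, hs, mul_assoc, hEV', mul_zero]
  have hVE : star x * (star V * y) = 0 := by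
    have := congrArg star (hor hy x)
    simpa only [star_mul, star_star, star_zero, mul_assoc] using this
  have h1 := hadd (x + y) (V * (x - y)) (hor (by rw [mul_add, hx, hy]) _)
  have h2 := hadd (x + V * x) (y + V * (-y)) (by
    simp only [IsOrtho, star_add, star_mul, add_mul, mul_add, mul_assoc, hor hx, hVE, hVV,
      mul_neg, hy]
    abel)
  have h3 := hadd x (V * x) (hor hx _)
  have h4 := hadd y (V * (-y)) (hor hy _)
  have h5 : x + y + V * (x - y) = x + V * x + (y + V * (-y)) := by
    simp only [mul_sub, mul_neg]
    abel
  have h := congrArg (E * ·) (h1.symm.trans ((congrArg Φ h5).trans h2))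
  simpa only [h3, h4, mul_add, hΦ.mul_eq_zero (hEV' _), hΦ.mul_eq_self hx, hΦ.mul_eq_self hy,
    hΦ.mul_eq_self (show E * (x + y) = x + y by rw [mul_add, hx, hy]), add_zero] using h

end VonNeumannAlgebra

open VonNeumannAlgebra in
theorem proposition3p4 {H : Type*} [NormedAddCommGroup H] [InnerProductSpace ℂ H]
    [CompleteSpace H] (M : VonNeumannAlgebra H) (Φ : M → M)
    (hadd : VonNeumannAlgebra.IsOrthoAdditive Φ)
    (hrange : VonNeumannAlgebra.IsRangeContractive Φ)
    (W : M) (hW : VonNeumannAlgebra.IsPartialIsometry W)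
    (hweak : VonNeumannAlgebra.IsWeaker (W * star W) (1 - W * star W)) :
    Φ W = W * Φ 1 := by
  obtain ⟨Q, hQ, hQle, V, hV, hVE, hVQ⟩ := hweak
  have hE : IsStarProjection (W * star W) := hVE ▸ hV
  have hEW : W * star W * W = W := hW.mul_star_mul_self
  generalize W * star W = E at hE hEW hQle hVE
  have hEi : E * E = E := hE.isIdempotentElem
  have hEQ : E * Q = 0 := by
    have hQ' : IsStarProjection (Q : H →L[ℂ] H) :=
      ⟨congrArg (Subtype.val : M → H →L[ℂ] H) hQ.isIdempotentElem,
        congrArg (Subtype.val : M → H →L[ℂ] H) hQ.isSelfAdjoint⟩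
    have hE' : IsStarProjection ((1 - E : M) : H →L[ℂ] H) :=
      ⟨congrArg (Subtype.val : M → H →L[ℂ] H) hE.one_sub.isIdempotentElem,
        congrArg (Subtype.val : M → H →L[ℂ] H) hE.one_sub.isSelfAdjoint⟩
    have h : (1 - E) * Q = Q := Subtype.ext ((hQ'.le_iff_mul_eq_right hE').1 hQle)
    rwa [sub_mul, one_mul, sub_eq_self] at h
  have hEV : E * V = 0 := by
    rw [← hV.mul_star_mul_self, hVQ, ← mul_assoc, hEQ, zero_mul]
  have hEWE : E * (W * E) = W * E := by rw [← mul_assoc, hEW]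
  have hEW' : E * (W * (1 - E)) = W * (1 - E) := by rw [← mul_assoc, hEW]
  have hsplit : Φ W = Φ (W * E) + Φ (W * (1 - E)) := by
    rw [← map_add_of_mul_eq_self hadd hrange hE hVE hEV hEWE hEW', ← mul_add, add_sub_cancel,
      mul_one]
  have h2 : Φ (W * (1 - E)) = W * ((1 - E) * Φ 1) := by
    rw [map_mul_of_orthogonal hadd hrange hE.one_sub hE.one_sub.isIdempotentElem
      (by rw [sub_mul, one_mul, hEW, sub_self]), map_isStarProjection hadd hrange hE.one_sub]
  have h1 : Φ (W * E) = W * (E * Φ 1) := by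
    have h : V * Φ (W * E) = V * W * (E * Φ 1) := by
      rw [← map_mul_of_orthogonal hadd hrange hE hEWE hEV, ← mul_assoc,
        map_mul_of_orthogonal hadd hrange hE hEi (by rw [← mul_assoc, hEV, zero_mul]),
        map_isStarProjection hadd hrange hE]
    have h' := congrArg (star V * ·) h
    simpa only [← mul_assoc, hVE, hEW, hrange.mul_eq_self hEWE] using h'
  rw [hsplit, h1, h2, ← mul_add, ← add_mul, add_sub_cancel, one_mul]
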